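/- Let $X$ be a finite set and $d \ge 1$. A point configuration in $\mathbb{R}^d$ with label set $X$ is a family $P=(p_i)_{i\in X}$ of points of $\mathbb{R}^d$ (repetitions allowed); it is full-dimensional if its affine hull is $\mathbb{R}^d$. Its chirotope is the map $\chi_P\colon X^{d+1}\to\{-,0,+\}$, \[ \chi_P(i_1,\dots,i_{d+1}) = \operatorname{sign}\det\begin{pmatrix} p_{i_1} & \cdots & p_{i_{d+1}}\\ 1 & \cdots & 1\end{pmatrix}. \] For a finite set $Y\supseteq X$, a configuration $\widehat P=(\widehat p_i)_{i\in Y}$ extends $P$ if $\widehat p_i=p_i$ for all $i\in X$. A map $\chi\colon Y^{d+1}\to\{-,0,+\}$ is realizable on top of $P$ if $\chi=\chi_{\widehat P}$ for some $\widehat P$ with label set $Y$ that extends $P$. Two configurations $P,Q$ with the same label set $X$ have the same extensions if, for every finite set $Y\supseteq X$ and every $\chi\colon Y^{d+1}\to\{-,0,+\}$, $\chi$ is realizable on top of $P$ if and only if it is realizable on top of $Q$. Two full-dimensional configurations $P=(p_i)_{i \in X}$ and $Q=(q_i)_{i\in X}$ in $\mathbb{R}^d$ are directly affinely equivalent if there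 is an invertible affine map $\phi\colon\mathbb{R}^d\to\mathbb{R}^d$ whose linear part has positive determinant such that $q_i=\phi(p_i)$ for all $i\in X$. **Proposition.** Let $d\ge 2$, let $X$ be a finite set, and let $P,Q\in(\mathbb{R}^d)^X$ be full-dimensional point configurations. Then $P$ and $Q$ have the same extensions if and only if they are directly affinely equivalent. -/

import Mathlib

universe u

/-- A point configuration in `ℝ^d` with label set `X`: a map `X → ℝ^d`.
Only the affine structure and the standard orientation of `ℝ^d` matter here. -/
abbrev PointConfig (d : ℕ) (X : Type u) : Type u := X → (Fin d → ℝ)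

/-- The orientation of a `(d+1)`-tuple of points of `ℝ^d`: the sign of the determinant of the
matrix whose `j`-th column is `p j` with an entry `1` appended below. -/
noncomputable def orientationSign {d : ℕ} (p : Fin (d + 1) → (Fin d → ℝ)) : SignType :=
  SignType.sign (Matrix.det
    (Matrix.of fun r j : Fin (d + 1) => (Fin.snoc (p j) 1 : Fin (d + 1) → ℝ) r))

/-- The chirotope of a point configuration. -/
noncomputable def chirotope {d : ℕ} {X : Type u} (P : PointConfig d X) :
    (Fin (d + 1) → X) → SignType :=
  fun t => orientationSign fun j => P (t j)

/-- `P` is full-dimensional if its affine hull is `ℝ^d`. -/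
def FullDimensional {d : ℕ} {X : Type u} (P : PointConfig d X) : Prop :=
  affineSpan ℝ (Set.range P) = ⊤

/-- `P'` extends `P`, where the labels `X` are regarded as a subset of the labels `Y` through
the injection `ι`: the restriction of `P'` to `X` is `P`. -/
def Extends {d : ℕ} {X Y : Type u} (ι : X ↪ Y) (P' : PointConfig d Y) (P : PointConfig d X) :
    Prop :=
  ∀ i, P' (ι i) = P i

/-- `χ` is realizable on top of `P`: some extension of `P` has chirotope `χ`. -/
def RealizableOnTop {d : ℕ} {X Y : Type u} (ι : X ↪ Y) (χ : (Fin (d + 1) → Y) → SignType)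
    (P : PointConfig d X) : Prop :=
  ∃ P' : PointConfig d Y, Extends ι P' P ∧ chirotope P' = χ

/-- `P` and `Q` have the same extensions: every finite chirotope (on any finite label set
containing `X`) realizable on top of one of them is realizable on top of the other. -/
def HaveSameExtensions {d : ℕ} {X : Type u} (P Q : PointConfig d X) : Prop :=
  ∀ (Y : Type u) [Finite Y] (ι : X ↪ Y) (χ : (Fin (d + 1) → Y) → SignType),
    RealizableOnTop ι χ P ↔ RealizableOnTop ι χ Q

/-- Direct affine equivalence of configurations in `ℝ^d` (meant for full-dimensional ones, whose
affine hulls are all of `ℝ^d`): an invertible affine transformation of `ℝ^d` that preserves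
orientation, i.e. whose linear part has positive determinant, maps each `P i` to `Q i`. -/
def DirectlyAffinelyEquivalent {d : ℕ} {X : Type u} (P Q : PointConfig d X) : Prop :=
  ∃ φ : (Fin d → ℝ) ≃ᵃ[ℝ] (Fin d → ℝ),
    0 < LinearMap.det (φ.linear : (Fin d → ℝ) →ₗ[ℝ] (Fin d → ℝ)) ∧ ∀ i, Q i = φ (P i)

/-! Orientation-preserving affine maps multiply all determinants by one positive constant, which
gives the easy direction. Conversely, fix labels `b` whose points form an affine basis. It suffices
that every point has the same barycentric coordinates in `P ∘ b` and `Q ∘ b`, since the bases are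
equally oriented. Signs of coordinates are orientations. For two positive coordinates of one point,
extra points in the plane of three basis points carry a von Staudt addition: collinearities force
integer multiples, and one further point exists in affine space exactly when `(m + 1) * p 0 < (n +
1) * p 1` (`SignTransfer.mul_lt_mul`). All these comparisons pass to `Q`, so the ratio does too. A
negative coordinate becomes a ratio of positive ones after exchanging a basis point with the given
point; the total 1 then fixes the positive coordinates (`HaveSameExtensions.bary_eq`). -/

/-- Homogeneous coordinates of a point. -/
def homog {d : ℕ} (x : Fin d → ℝ) : Fin (d + 1) → ℝ := Fin.snoc x 1

/-- The matrix whose columns are the homogeneous coordinates of the points `p j`. -/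
def homogMatrix {d : ℕ} (p : Fin (d + 1) → (Fin d → ℝ)) : Matrix (Fin (d + 1)) (Fin (d + 1)) ℝ :=
  Matrix.of fun r j => homog (p j) r

theorem orientationSign_eq {d : ℕ} (p : Fin (d + 1) → (Fin d → ℝ)) :
    orientationSign p = SignType.sign (homogMatrix p).det := rfl

theorem homog_last {d : ℕ} (x : Fin d → ℝ) : homog x (Fin.last d) = 1 := by
  simp [homog]

theorem homog_castSucc {d : ℕ} (x : Fin d → ℝ) (i : Fin d) : homog x i.castSucc = x i := by
  simp [homog]

theorem exists_homog_eq {d : ℕ} {v : Fin (d + 1) → ℝ} (hv : v (Fin.last d) = 1) :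
    ∃ x, homog x = v :=
  ⟨Fin.init v, by rw [homog, ← hv, Fin.snoc_init_self]⟩

/-! ### Barycentric coordinates as determinants -/

/-- Barycentric coordinates of `x` with respect to the points `b`. -/
noncomputable def bary {d : ℕ} (b : Fin (d + 1) → (Fin d → ℝ)) (x : Fin d → ℝ) :
    Fin (d + 1) → ℝ :=
  (homogMatrix b)⁻¹.mulVec (homog x)

section Bary

variable {d : ℕ} {b : Fin (d + 1) → (Fin d → ℝ)}

theorem homogMatrix_mulVec_bary (hb : (homogMatrix b).det ≠ 0)
    (x : Fin d → ℝ) :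
    (homogMatrix b).mulVec (bary b x) = homog x := by
  rw [bary, Matrix.mulVec_mulVec, Matrix.mul_nonsing_inv _ hb.isUnit, Matrix.one_mulVec]

theorem bary_eq_of_mulVec_eq (hb : (homogMatrix b).det ≠ 0)
    {x : Fin d → ℝ} {c : Fin (d + 1) → ℝ}
    (h : (homogMatrix b).mulVec c = homog x) : bary b x = c := by
  rw [bary, ← h, Matrix.mulVec_mulVec, Matrix.nonsing_inv_mul _ hb.isUnit, Matrix.one_mulVec]

theorem homogMatrix_mulVec_last (c : Fin (d + 1) → ℝ) :
    (homogMatrix b).mulVec c (Fin.last d) = ∑ l, c l := by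
  simp [Matrix.mulVec, dotProduct, homogMatrix, homog_last]

theorem sum_bary (hb : (homogMatrix b).det ≠ 0)
    (x : Fin d → ℝ) : ∑ l, bary b x l = 1 := by
  rw [← homogMatrix_mulVec_last (b := b), homogMatrix_mulVec_bary hb, homog_last]

theorem bary_self (hb : (homogMatrix b).det ≠ 0)
    (j : Fin (d + 1)) : bary b (b j) = Pi.single j 1 := by
  apply bary_eq_of_mulVec_eq hb
  rw [Matrix.mulVec_single_one]
  rfl

theorem exists_bary_eq (hb : (homogMatrix b).det ≠ 0)
    {c : Fin (d + 1) → ℝ} (hc : ∑ l, c l = 1) : ∃ x, bary b x = c := by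
  obtain ⟨x, hx⟩ := exists_homog_eq (v := (homogMatrix b).mulVec c)
    (by rw [homogMatrix_mulVec_last, hc])
  exact ⟨x, bary_eq_of_mulVec_eq hb hx.symm⟩

theorem homogMatrix_eq_mul (hb : (homogMatrix b).det ≠ 0)
    (p : Fin (d + 1) → (Fin d → ℝ)) :
    homogMatrix p = homogMatrix b * Matrix.of fun l j => bary b (p j) l := by
  ext r j
  have := congrFun (homogMatrix_mulVec_bary hb (p j)) r
  rw [Matrix.mul_apply]
  exact this.symm

/-- Replacing some columns of the identity matrix leaves a minor as the determinant. -/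
theorem det_extend_single {n k : ℕ} (κ : Fin k → Fin n) (hκ : Function.Injective κ)
    (y : Fin k → Fin n → ℝ) :
    (Matrix.of fun l j => Function.extend κ y (fun i => Pi.single i (1 : ℝ)) j l).det =
      (Matrix.of fun i j => y j (κ i)).det := by
  -- The matrix is the identity plus a product through `Fin k`; `det (1 + U * W) = det (1 + W * U)`
  -- then shrinks the determinant to size `k`.
  have key : (Matrix.of fun l j => Function.extend κ y (fun i => Pi.single i (1 : ℝ)) j l) =
      1 + (Matrix.of fun l j => y j l - (Pi.single (κ j) (1 : ℝ) : Fin n → ℝ) l) *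
        (Matrix.of fun i l => (Pi.single (κ i) (1 : ℝ) : Fin n → ℝ) l) := by
    ext l j
    simp only [Matrix.of_apply, Matrix.add_apply, Matrix.mul_apply]
    by_cases hj : ∃ i, κ i = j
    · obtain ⟨i, rfl⟩ := hj
      rw [hκ.extend_apply, Finset.sum_eq_single i]
      · simp [Matrix.one_apply, Pi.single_apply]
      · intro i' _ hi'
        simp [Pi.single_apply, hκ.eq_iff, hi'.symm]
      · simp
    · rw [Function.extend_apply' _ _ _ hj, Finset.sum_eq_zero]
      · simp [Matrix.one_apply, Pi.single_apply]
      · intro i' _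
        have : j ≠ κ i' := fun h => hj ⟨i', h.symm⟩
        simp [Pi.single_apply, this]
  rw [key, Matrix.det_one_add_mul_comm]
  congr 1
  ext i j
  simp only [Matrix.of_apply, Matrix.add_apply, Matrix.mul_apply]
  rw [Finset.sum_eq_single (κ i)]
  · simp [Matrix.one_apply, Pi.single_apply, hκ.eq_iff]
  · intro l _ hl
    simp [hl]
  · simp

/-- Cramer's rule for several columns at once: after factoring out `homogMatrix b`, the untouched
columns are unit vectors. -/
theorem det_homogMatrix_extend (hb : (homogMatrix b).det ≠ 0)
    {k : ℕ} (κ : Fin k → Fin (d + 1)) (hκ : Function.Injective κ)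
    (y : Fin k → (Fin d → ℝ)) :
    (homogMatrix (Function.extend κ y b)).det =
      (homogMatrix b).det * (Matrix.of fun i j => bary b (y j) (κ i)).det := by
  rw [homogMatrix_eq_mul hb, Matrix.det_mul, ← det_extend_single κ hκ fun j => bary b (y j)]
  congr 3
  ext l j
  by_cases hj : ∃ i, κ i = j
  · obtain ⟨i, rfl⟩ := hj
    simp only [hκ.extend_apply]
  · simp only [Function.extend_apply' _ _ _ hj, bary_self hb]

theorem det_homogMatrix_update (hb : (homogMatrix b).det ≠ 0)
    (j : Fin (d + 1)) (x : Fin d → ℝ) :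
    (homogMatrix (Function.update b j x)).det = (homogMatrix b).det * bary b x j := by
  have h := det_homogMatrix_extend hb (fun _ : Fin 1 => j) (Function.injective_of_subsingleton _)
    (fun _ => x)
  rw [Matrix.det_unique (Matrix.of fun _ _ : Fin 1 => bary b x j), Matrix.of_apply] at h
  rw [← h]
  congr 2
  ext l : 1
  by_cases hl : l = j
  · subst hl
    rw [Function.update_self]
    exact ((Function.injective_of_subsingleton fun _ : Fin 1 => l).extend_apply
      (fun _ => x) b 0).symm
  · rw [Function.update_of_ne hl, Function.extend_apply']
    rintro ⟨_, h⟩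
    exact hl h.symm

end Bary

theorem FullDimensional.exists_det_ne_zero {d : ℕ} {X : Type u} {P : PointConfig d X}
    (hP : FullDimensional P) :
    ∃ b : Fin (d + 1) → X, (homogMatrix (P ∘ b)).det ≠ 0 := by
  obtain ⟨t, hts, hspan, hind⟩ := exists_affineIndependent ℝ (Fin d → ℝ) (Set.range P)
  rw [hP] at hspan
  have hfin : Finite t := finite_set_of_fin_dim_affineIndependent ℝ hind
  have := Fintype.ofFinite t
  have hcard : Fintype.card t = d + 1 := by
    have h := (hind.affineSpan_eq_top_iff_card_eq_finrank_add_one).1 (by simpa using hspan)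
    simpa using h
  let e : Fin (d + 1) ≃ t := (Fintype.equivFinOfCardEq hcard).symm
  choose b hb using fun j => hts (e j).2
  refine ⟨b, fun h0 => ?_⟩
  obtain ⟨v, hv, hMv⟩ := Matrix.exists_mulVec_eq_zero_iff.2 h0
  have hind' : AffineIndependent ℝ (P ∘ b) := by
    have h := hind.comp_embedding e.toEmbedding
    have hPb : P ∘ b = Subtype.val ∘ e.toEmbedding := funext hb
    rwa [hPb]
  rw [affineIndependent_iff] at hind'
  apply hv
  ext j
  refine hind' Finset.univ v ?_ ?_ j (Finset.mem_univ j)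
  · rw [← homogMatrix_mulVec_last (b := P ∘ b), hMv, Pi.zero_apply]
  · ext r
    have h := congrFun hMv r.castSucc
    simp only [Matrix.mulVec, dotProduct, homogMatrix, Matrix.of_apply, homog_castSucc] at h
    simpa [mul_comm] using h

/-! ### Comparing integer multiples by incidences in a plane -/

/-- The determinant of three vectors of `ℝ³`. -/
def tripleDet (u v w : Fin 3 → ℝ) : ℝ :=
  u 0 * (v 1 * w 2 - v 2 * w 1) - u 1 * (v 0 * w 2 - v 2 * w 0) + u 2 * (v 0 * w 1 - v 1 * w 0)

theorem det_of_columns (M : Fin 3 → Fin 3 → ℝ) :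
    (Matrix.of fun r j => M j r).det = tripleDet (M 0) (M 1) (M 2) := by
  rw [Matrix.det_fin_three, tripleDet]
  simp only [Matrix.of_apply]
  ring

/-- A finite family of vectors of `ℝ³` with positive coordinate sums, seen next to `p` and the
coordinate vectors, has a counterpart next to `q` with the same signs of all `3 × 3` determinants,
consisting of vectors with coordinate sum `1`. -/
def SignTransfer (p q : Fin 3 → ℝ) : Prop :=
  ∀ (ι : Type) [Finite ι] (c : ι → Fin 3 → ℝ), (∀ k, 0 < ∑ r, c k r) →
    ∃ c' : ι → Fin 3 → ℝ, (∀ k, ∑ r, c' k r = 1) ∧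
      ∀ x y z : Fin 3 ⊕ (Unit ⊕ ι),
        let A : Fin 3 ⊕ (Unit ⊕ ι) → Fin 3 → ℝ :=
          Sum.elim (fun s => Pi.single s 1) (Sum.elim (fun _ => p) c)
        let B : Fin 3 ⊕ (Unit ⊕ ι) → Fin 3 → ℝ :=
          Sum.elim (fun s => Pi.single s 1) (Sum.elim (fun _ => q) c')
        SignType.sign (tripleDet (A x) (A y) (A z)) = SignType.sign (tripleDet (B x) (B y) (B z))

/-- In the chart dividing by coordinate 2, `x k` lies at the height of `g`, and `s k` is its
projection to the axis. The direction `e` is that of `g`, so each step from `s k` to `x (k + 1)`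
moves by `g`. Hence `s k` sits at `k + 1` times the abscissa of `g`. -/
theorem multiples_of_incidences {N : ℕ} {e₀ e₁ g₀ g₁ g₂ : ℝ} {x₀ x₁ x₂ s₀ s₂ : ℕ → ℝ}
    (he₁ : 0 < e₁) (hge : g₀ * e₁ = g₁ * e₀)
    (hx₂ : ∀ k ≤ N, 0 < x₂ k) (hs₂ : ∀ k ≤ N, 0 < s₂ k)
    (hgx : ∀ k ≤ N, g₁ * x₂ k = g₂ * x₁ k)
    (hx : x₀ 0 * e₁ = x₁ 0 * e₀)
    (hsx : ∀ k ≤ N, x₀ k * s₂ k = x₂ k * s₀ k)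
    (hstep : ∀ k < N, s₀ k * e₁ * x₂ (k + 1) + s₂ k * e₀ * x₁ (k + 1) = s₂ k * e₁ * x₀ (k + 1)) :
    ∀ k ≤ N, s₀ k * g₂ = (k + 1) * g₀ * s₂ k := by
  have side : ∀ k ≤ N, x₀ k * g₂ = (k + 1) * g₀ * x₂ k → s₀ k * g₂ = (k + 1) * g₀ * s₂ k := by
    intro k hk h
    apply mul_left_cancel₀ (hx₂ k hk).ne'
    linear_combination s₂ k * h - g₂ * hsx k hk
  intro k
  induction k with
  | zero =>
    intro hk
    apply side 0 hk
    apply mul_left_cancel₀ he₁.ne'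
    push_cast
    linear_combination g₂ * hx - e₀ * hgx 0 hk - x₂ 0 * hge
  | succ k ih =>
    intro hk
    have ih := ih (by omega)
    apply side (k + 1) hk
    apply mul_left_cancel₀ (mul_pos (hs₂ k (by omega)) he₁).ne'
    push_cast
    linear_combination -g₂ * hstep k (by omega) + e₁ * x₂ (k + 1) * ih
      - s₂ k * e₀ * hgx (k + 1) hk - s₂ k * x₂ (k + 1) * hge

/-- Collinearity of `s`, `t`, `h` gives `m * q₀ * h₁ = -(n * q₁ * h₀)`. The normalization `h₁ = 1 -
h₀ > -h₀ > 0` turns this into a strict inequality. -/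
theorem lt_of_harmonic {s₀ s₂ t₁ t₂ h₀ h₁ g₀ g₁ g₂ e₀ e₁ q₀ q₁ m n : ℝ}
    (hs : s₀ * g₂ = m * g₀ * s₂) (ht : t₁ * g₂ = n * g₁ * t₂) (hs₂ : 0 < s₂) (ht₂ : 0 < t₂)
    (hg₀ : 0 < g₀) (hq₀ : 0 < q₀) (hm : 0 < m) (he₁ : 0 < e₁)
    (hge : g₀ * e₁ = g₁ * e₀) (hqe : q₀ * e₁ = q₁ * e₀)
    (hst : s₀ * t₂ * h₁ + s₂ * t₁ * h₀ = 0) (hh₀ : h₀ < 0) (hh : h₀ + h₁ = 1) :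
    m * q₀ < n * q₁ := by
  have h1 : m * g₀ * h₁ + n * g₁ * h₀ = 0 := by
    apply mul_left_cancel₀ (mul_pos hs₂ ht₂).ne'
    linear_combination g₂ * hst - t₂ * h₁ * hs - s₂ * h₀ * ht
  have h2 : m * q₀ * h₁ + n * q₁ * h₀ = 0 := by
    apply mul_left_cancel₀ (mul_pos hg₀ he₁).ne'
    linear_combination q₁ * e₀ * h1 + m * g₀ * h₁ * hqe + n * q₁ * h₀ * hge
  nlinarith [mul_pos hm hq₀]

theorem SignTransfer.mul_lt_mul {p q : Fin 3 → ℝ} (h : SignTransfer p q) (hp₀ : 0 < p 0)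
    (hp₁ : 0 < p 1) (hq₀ : 0 < q 0) (m n : ℕ)
    (hmn : (m + 1) * p 0 < (n + 1) * p 1) : (m + 1) * q 0 < (n + 1) * q 1 := by
  obtain ⟨N, hmN, hnN⟩ : ∃ N, m ≤ N ∧ n ≤ N := ⟨max m n, le_max_left _ _, le_max_right _ _⟩
  let a : ℝ := p 0
  let b : ℝ := p 1
  -- With `V 0 V 1` as line at infinity, the first three points are the direction of `p`, a finite
  -- point in that direction, and the direction from `((m + 1) * a, 0)` to `(0, (n + 1) * b)`. The
  -- last has positive coordinate sum precisely by `hmn`. The four sequences are the multiples along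
  -- each axis and their auxiliary points.
  obtain ⟨c', hsum, hsign⟩ := h (Fin 3 ⊕ (Fin 4 × Fin (N + 1)))
    (Sum.elim ![![a, b, 0], ![a, b, 1], ![-((m + 1) * a), (n + 1) * b, 0]]
      fun jk => (![![(jk.2 + 1) * a, b, 1], ![(jk.2 + 1) * a, 0, 1],
        ![a, (jk.2 + 1) * b, 1], ![0, (jk.2 + 1) * b, 1]] : Fin 4 → Fin 3 → ℝ) jk.1) (by
    rintro (k | ⟨j, k⟩)
    · fin_cases k <;> simp [Fin.sum_univ_three, a, b] <;> linarith
    · fin_cases j <;> simp [Fin.sum_univ_three, a, b] <;> positivity)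
  let V : Fin 3 → Fin 3 ⊕ (Unit ⊕ (Fin 3 ⊕ (Fin 4 × Fin (N + 1)))) := Sum.inl
  let p' : Fin 3 ⊕ (Unit ⊕ (Fin 3 ⊕ (Fin 4 × Fin (N + 1)))) := Sum.inr (Sum.inl ())
  let A : Fin 3 → Fin 3 ⊕ (Unit ⊕ (Fin 3 ⊕ (Fin 4 × Fin (N + 1)))) :=
    fun k => Sum.inr (Sum.inr (Sum.inl k))
  let S : Fin 4 → Fin (N + 1) → Fin 3 ⊕ (Unit ⊕ (Fin 3 ⊕ (Fin 4 × Fin (N + 1)))) :=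
    fun j k => Sum.inr (Sum.inr (Sum.inr (j, k)))
  have zero : ∀ {r t : ℝ}, SignType.sign r = SignType.sign t → r = 0 → t = 0 := by
    intro r t hrt hr
    rw [hr, sign_zero] at hrt
    exact sign_eq_zero_iff.1 hrt.symm
  have pos : ∀ {r t : ℝ}, SignType.sign r = SignType.sign t → 0 < r → 0 < t := by
    intro r t hrt hr
    rw [sign_pos hr] at hrt
    exact sign_eq_one_iff.1 hrt.symm
  set E := c' (Sum.inl 0) with hE
  set G := c' (Sum.inl 1) with hG
  set H := c' (Sum.inl 2) with hH
  set T : Fin 4 → Fin (N + 1) → Fin 3 → ℝ := fun j k => c' (Sum.inr (j, k)) with hT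
  -- A determinant with two coordinate vectors reads off one coordinate up to sign; the other
  -- vanishing determinants below are collinearities.
  have e0 : 0 < E 0 := by
    have := pos (hsign (A 0) (V 1) (V 2)) (by simp [A, V, tripleDet, a, b, hp₀])
    simpa [A, V, tripleDet] using this
  have e1 : 0 < E 1 := by
    have := pos (hsign (V 0) (A 0) (V 2)) (by simp [A, V, tripleDet, a, b, hp₁])
    simpa [A, V, tripleDet] using this
  have e2 : E 2 = 0 := by
    have := zero (hsign (V 0) (V 1) (A 0)) (by simp [A, V, tripleDet])
    simpa [A, V, tripleDet] using this
  have g0 : 0 < G 0 := by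
    have := pos (hsign (A 1) (V 1) (V 2)) (by simp [A, V, tripleDet, a, b, hp₀])
    simpa [A, V, tripleDet] using this
  have qe : q 0 * E 1 = q 1 * E 0 := by
    have := zero (hsign (V 2) p' (A 0)) (by simp [A, V, p', tripleDet, a, b]; ring)
    simp [A, V, p', tripleDet, ← hE] at this
    linarith
  have ge : G 0 * E 1 = G 1 * E 0 := by
    have := zero (hsign (V 2) (A 1) (A 0)) (by simp [A, V, tripleDet, a, b]; ring)
    simp [A, V, tripleDet, ← hE, ← hG] at this
    linarith
  have h2 : H 2 = 0 := by
    have := zero (hsign (V 0) (V 1) (A 2)) (by simp [A, V, tripleDet])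
    simpa [A, V, tripleDet] using this
  have h0 : H 0 < 0 := by
    have := pos (hsign (V 2) (V 1) (A 2)) (by simp [A, V, tripleDet, a, b]; positivity)
    simpa [A, V, tripleDet] using this
  have T2 : ∀ j k, 0 < T j k 2 := by
    intro j k
    have := pos (hsign (V 0) (V 1) (S j k)) (by fin_cases j <;> simp [S, V, tripleDet])
    simpa [S, V, tripleDet] using this
  have s1 : ∀ k, T 1 k 1 = 0 := by
    intro k
    have := zero (hsign (V 0) (S 1 k) (V 2)) (by simp [S, V, tripleDet])
    simpa [S, V, tripleDet] using this
  have t0 : ∀ k, T 3 k 0 = 0 := by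
    intro k
    have := zero (hsign (S 3 k) (V 1) (V 2)) (by simp [S, V, tripleDet])
    simpa [S, V, tripleDet] using this
  have gx : ∀ k, G 1 * T 0 k 2 = G 2 * T 0 k 1 := by
    intro k
    have := zero (hsign (V 0) (A 1) (S 0 k)) (by simp [S, A, V, tripleDet])
    simp [S, A, V, tripleDet, ← hG] at this
    simp only [hT]
    linarith
  have gy : ∀ k, G 0 * T 2 k 2 = G 2 * T 2 k 0 := by
    intro k
    have := zero (hsign (V 1) (A 1) (S 2 k)) (by simp [S, A, V, tripleDet])
    simp [S, A, V, tripleDet, ← hG] at this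
    simp only [hT]
    linarith
  have x0 : T 0 0 0 * E 1 = T 0 0 1 * E 0 := by
    have := zero (hsign (V 2) (A 0) (S 0 0)) (by simp [S, A, V, tripleDet]; ring)
    simp [S, A, V, tripleDet, ← hE] at this
    simp only [hT]
    linarith
  have y0 : T 2 0 1 * E 0 = T 2 0 0 * E 1 := by
    have := zero (hsign (V 2) (A 0) (S 2 0)) (by simp [S, A, V, tripleDet]; ring)
    simp [S, A, V, tripleDet, ← hE] at this
    simp only [hT]
    linarith
  have sx : ∀ k, T 0 k 0 * T 1 k 2 = T 0 k 2 * T 1 k 0 := by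
    intro k
    have := zero (hsign (V 1) (S 0 k) (S 1 k)) (by simp [S, V, tripleDet])
    simp [S, V, tripleDet] at this
    simp only [hT]
    linarith
  have ty : ∀ k, T 2 k 1 * T 3 k 2 = T 2 k 2 * T 3 k 1 := by
    intro k
    have := zero (hsign (V 0) (S 2 k) (S 3 k)) (by simp [S, V, tripleDet])
    simp [S, V, tripleDet] at this
    simp only [hT]
    linarith
  have xstep : ∀ k l : Fin (N + 1), (l : ℕ) = k + 1 →
      T 1 k 0 * E 1 * T 0 l 2 + T 1 k 2 * E 0 * T 0 l 1 = T 1 k 2 * E 1 * T 0 l 0 := by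
    intro k l hkl
    have := zero (hsign (S 1 k) (A 0) (S 0 l)) (by simp [S, A, tripleDet, hkl]; ring)
    have hs := s1 k
    simp only [hT] at hs ⊢
    simp [S, A, tripleDet, ← hE, hs, e2] at this
    linarith
  have ystep : ∀ k l : Fin (N + 1), (l : ℕ) = k + 1 →
      T 3 k 1 * E 0 * T 2 l 2 + T 3 k 2 * E 1 * T 2 l 0 = T 3 k 2 * E 0 * T 2 l 1 := by
    intro k l hkl
    have := zero (hsign (S 3 k) (A 0) (S 2 l)) (by simp [S, A, tripleDet, hkl]; ring)
    have hs := t0 k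
    simp only [hT] at hs ⊢
    simp [S, A, tripleDet, ← hE, hs, e2] at this
    linarith
  -- `Fin.ofNat` reduces modulo `N + 1`, harmless in the range used.
  have val : ∀ k ≤ N, ((Fin.ofNat (N + 1) k : Fin (N + 1)) : ℕ) = k := fun k hk => by
    simp [Fin.ofNat, Nat.mod_eq_of_lt (Nat.lt_succ_of_le hk)]
  have hs := multiples_of_incidences (N := N) (x₀ := fun k => T 0 (Fin.ofNat _ k) 0)
    (x₁ := fun k => T 0 (Fin.ofNat _ k) 1) (x₂ := fun k => T 0 (Fin.ofNat _ k) 2)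
    (s₀ := fun k => T 1 (Fin.ofNat _ k) 0) (s₂ := fun k => T 1 (Fin.ofNat _ k) 2)
    e1 ge (fun _ _ => T2 _ _) (fun _ _ => T2 _ _) (fun _ _ => gx _) x0 (fun _ _ => sx _)
    (fun k hk => xstep _ _ (by rw [val _ hk, val _ hk.le])) m hmN
  have ht := multiples_of_incidences (N := N) (x₀ := fun k => T 2 (Fin.ofNat _ k) 1)
    (x₁ := fun k => T 2 (Fin.ofNat _ k) 0) (x₂ := fun k => T 2 (Fin.ofNat _ k) 2)
    (s₀ := fun k => T 3 (Fin.ofNat _ k) 1) (s₂ := fun k => T 3 (Fin.ofNat _ k) 2)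
    e0 ge.symm (fun _ _ => T2 _ _) (fun _ _ => T2 _ _) (fun _ _ => gy _) y0 (fun _ _ => ty _)
    (fun k hk => ystep _ _ (by rw [val _ hk, val _ hk.le])) n hnN
  refine lt_of_harmonic hs ht (T2 _ _) (T2 _ _) g0 hq₀ (by positivity) e1 ge qe
    (h₀ := H 0) (h₁ := H 1) ?_ h0 ?_
  · have := zero (hsign (S 1 (Fin.ofNat _ m)) (S 3 (Fin.ofNat _ n)) (A 2))
      (by
        simp [S, A, tripleDet, Nat.mod_eq_of_lt (Nat.lt_succ_of_le hmN),
          Nat.mod_eq_of_lt (Nat.lt_succ_of_le hnN)]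
        ring)
    have hs := s1 (Fin.ofNat _ m)
    have ht := t0 (Fin.ofNat _ n)
    simp only [hT] at hs ht ⊢
    simp [S, A, tripleDet, -Fin.ofNat_eq_cast, ← hH, hs, ht, h2] at this
    linarith
  · have := hsum (Sum.inl 2)
    rw [Fin.sum_univ_three, ← hH, h2] at this
    linarith

/-- Otherwise a rational `(n + 1) / (m + 1)` lies strictly between `p 0 / p 1` and `q 0 / q 1`,
contradicting `SignTransfer.mul_lt_mul`. -/
theorem SignTransfer.ratio_le {p q : Fin 3 → ℝ} (h : SignTransfer p q) (hp₀ : 0 < p 0)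
    (hp₁ : 0 < p 1) (hq₀ : 0 < q 0) (hq₁ : 0 < q 1) : q 0 * p 1 ≤ p 0 * q 1 := by
  by_contra! hlt
  obtain ⟨r, hr₁, hr₂⟩ := exists_rat_btwn (show p 0 / p 1 < q 0 / q 1 by
    rwa [div_lt_div_iff₀ hp₁ hq₁])
  have hr : 0 < r := by exact_mod_cast (div_pos hp₀ hp₁).trans hr₁
  obtain ⟨m, hm⟩ : ∃ m, r.den = m + 1 := ⟨r.den - 1, by have := r.den_pos; omega⟩
  obtain ⟨n, hn⟩ : ∃ n : ℕ, r.num = n + 1 :=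
    ⟨(r.num - 1).toNat, by have := Rat.num_pos.2 hr; omega⟩
  have hrr : (r : ℝ) = (n + 1) / (m + 1) := by
    rw [Rat.cast_def, hn, hm]
    push_cast
    rfl
  rw [hrr] at hr₁ hr₂
  have hm' : (0 : ℝ) < m + 1 := by positivity
  rw [div_lt_div_iff₀ hp₁ hm'] at hr₁
  rw [div_lt_div_iff₀ hm' hq₁] at hr₂
  have := h.mul_lt_mul hp₀ hp₁ hq₀ m n (by linarith)
  linarith

/-! ### From equal extensions to equal ratios of positive coordinates -/

section Extensions

variable {d : ℕ} {X : Type u} {P Q : PointConfig d X}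

theorem HaveSameExtensions.symm (h : HaveSameExtensions P Q) : HaveSameExtensions Q P :=
  fun Y _ ι χ => (h Y ι χ).symm

theorem HaveSameExtensions.exists_family [Finite X] (h : HaveSameExtensions P Q)
    {ι : Type} [Finite ι] (w : ι → Fin d → ℝ) :
    ∃ w' : ι → Fin d → ℝ, ∀ t : Fin (d + 1) → X ⊕ ι,
      SignType.sign (homogMatrix (Sum.elim P w ∘ t)).det =
        SignType.sign (homogMatrix (Sum.elim Q w' ∘ t)).det := by
  obtain ⟨R, hR, hχ⟩ := (h (X ⊕ ULift.{u} ι) ⟨Sum.inl, Sum.inl_injective⟩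
    (chirotope (Sum.elim P (w ∘ ULift.down)))).1 ⟨_, fun i => rfl, rfl⟩
  refine ⟨fun k => R (Sum.inr ⟨k⟩), fun t => ?_⟩
  have := congrFun hχ fun j => Sum.map id ULift.up (t j)
  simp only [chirotope, orientationSign_eq] at this
  convert this.symm using 4
  · ext1 j
    rcases hj : t j with i | k <;> simp [hj]
  · ext1 j
    rcases hj : t j with i | k <;> simp [hj]
    exact (hR i).symm

theorem HaveSameExtensions.sign_det_eq [Finite X] (h : HaveSameExtensions P Q)
    (t : Fin (d + 1) → X) :
    SignType.sign (homogMatrix (P ∘ t)).det = SignType.sign (homogMatrix (Q ∘ t)).det := by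
  obtain ⟨w', hw'⟩ := h.exists_family (ι := Empty) Empty.elim
  exact hw' (Sum.inl ∘ t)

theorem HaveSameExtensions.det_ne_zero [Finite X] (h : HaveSameExtensions P Q)
    {t : Fin (d + 1) → X} (ht : (homogMatrix (P ∘ t)).det ≠ 0) :
    (homogMatrix (Q ∘ t)).det ≠ 0 := by
  rwa [← sign_ne_zero, ← h.sign_det_eq, sign_ne_zero]

/-- Signs of minors of barycentric coordinates are determined by orientations. -/
theorem sign_minor_eq {Y : Type*} {A B : Y → Fin d → ℝ}
    (hAB : ∀ t : Fin (d + 1) → Y, SignType.sign (homogMatrix (A ∘ t)).det =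
      SignType.sign (homogMatrix (B ∘ t)).det)
    {b : Fin (d + 1) → Y} (hA : (homogMatrix (A ∘ b)).det ≠ 0) {n : ℕ}
    {κ : Fin n → Fin (d + 1)} (hκ : Function.Injective κ) (y : Fin n → Y) :
    SignType.sign (Matrix.of fun i j => bary (A ∘ b) (A (y j)) (κ i)).det =
      SignType.sign (Matrix.of fun i j => bary (B ∘ b) (B (y j)) (κ i)).det := by
  have hB : (homogMatrix (B ∘ b)).det ≠ 0 := by rwa [← sign_ne_zero, ← hAB, sign_ne_zero]
  have ext : ∀ C : Y → Fin d → ℝ,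
      C ∘ Function.extend κ y b = Function.extend κ (C ∘ y) (C ∘ b) := by
    intro C
    ext1 l
    by_cases hl : ∃ i, κ i = l
    · obtain ⟨i, rfl⟩ := hl
      simp [hκ.extend_apply]
    · simp [Function.extend_apply' _ _ _ hl]
  have key := hAB (Function.extend κ y b)
  rw [ext, ext, det_homogMatrix_extend hA κ hκ, det_homogMatrix_extend hB κ hκ, sign_mul,
    sign_mul, hAB] at key
  exact mul_left_cancel₀ (sign_ne_zero.2 hB) key

theorem sign_bary_eq {Y : Type*} {A B : Y → Fin d → ℝ}
    (hAB : ∀ t : Fin (d + 1) → Y, SignType.sign (homogMatrix (A ∘ t)).det =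
      SignType.sign (homogMatrix (B ∘ t)).det)
    {b : Fin (d + 1) → Y} (hA : (homogMatrix (A ∘ b)).det ≠ 0) (y : Y) (l : Fin (d + 1)) :
    SignType.sign (bary (A ∘ b) (A y) l) = SignType.sign (bary (B ∘ b) (B y) l) := by
  have := sign_minor_eq hAB hA (Function.injective_of_subsingleton fun _ : Fin 1 => l)
    (fun _ => y)
  simpa using this

/-- Minors on the rows `κ` ignore the other coordinates, so `P i` acts as its projection to the
plane of three basis points. Positive coordinate sums let the new vectors be rescaled to affine
points without changing signs. -/
theorem HaveSameExtensions.signTransfer [Finite X] (h : HaveSameExtensions P Q)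
    {b : Fin (d + 1) → X} (hb : (homogMatrix (P ∘ b)).det ≠ 0)
    {κ : Fin 3 → Fin (d + 1)} (hκ : Function.Injective κ) (i : X) :
    SignTransfer (fun r => bary (P ∘ b) (P i) (κ r)) (fun r => bary (Q ∘ b) (Q i) (κ r)) := by
  intro ι _ c hc
  have hb' := h.det_ne_zero hb
  have hcoord : ∀ k, ∑ l, Function.extend κ (fun r => (∑ r, c k r)⁻¹ * c k r) 0 l = 1 := by
    intro k
    rw [← Fintype.sum_of_injective κ hκ (fun r => (∑ r, c k r)⁻¹ * c k r)
      (Function.extend κ (fun r => (∑ r, c k r)⁻¹ * c k r) 0)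
      (fun l hl => Function.extend_apply' _ _ _ hl) (fun r => by rw [hκ.extend_apply]),
      ← Finset.mul_sum, inv_mul_cancel₀ (hc k).ne']
  choose w hw using fun k => exists_bary_eq hb (hcoord k)
  obtain ⟨w', hw'⟩ := h.exists_family w
  have hinl : ∀ C : PointConfig d X, ∀ v : ι → Fin d → ℝ, Sum.elim C v ∘ (Sum.inl ∘ b) = C ∘ b :=
    fun _ _ => rfl
  refine ⟨fun k r => bary (Q ∘ b) (w' k) (κ r), fun k => ?_, fun x y z => ?_⟩
  · rw [Fintype.sum_of_injective κ hκ _ (bary (Q ∘ b) (w' k)) (fun l hl => ?_) (fun _ => rfl),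
      sum_bary hb']
    -- Coordinates outside `κ` vanish over `P`, hence over `Q`: the new points stay in the plane.
    have := sign_bary_eq hw' (b := Sum.inl ∘ b) hb (Sum.inr k) l
    rw [hinl, hinl, Sum.elim_inr, Sum.elim_inr, hw, Function.extend_apply' _ _ _ hl,
      Pi.zero_apply, sign_zero] at this
    exact sign_eq_zero_iff.1 this.symm
  · intro A B
    let θ : Fin 3 ⊕ (Unit ⊕ ι) → X ⊕ ι :=
      Sum.elim (fun s => Sum.inl (b (κ s))) (Sum.elim (fun _ => Sum.inl i) Sum.inr)
    let σ : Fin 3 ⊕ (Unit ⊕ ι) → ℝ := Sum.elim 1 (Sum.elim 1 fun k => (∑ r, c k r)⁻¹)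
    have hσ : ∀ x, 0 < σ x := by
      rintro (_ | _ | k) <;> simp [σ]
      exact hc k
    have hA : ∀ x r, bary (P ∘ b) (Sum.elim P w (θ x)) (κ r) = σ x * A x r := by
      rintro (s | _ | k) r
      · have := congrFun (bary_self hb (κ s)) (κ r)
        simp only [Function.comp_apply] at this
        simp [θ, σ, A, this, Pi.single_apply, hκ.eq_iff]
      · simp [θ, σ, A]
      · simp [θ, σ, A, hw, hκ.extend_apply]
    have hB : ∀ x r, bary (Q ∘ b) (Sum.elim Q w' (θ x)) (κ r) = B x r := by
      rintro (s | _ | k) r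
      · have := congrFun (bary_self hb' (κ s)) (κ r)
        simp only [Function.comp_apply] at this
        simp [θ, B, this, Pi.single_apply, hκ.eq_iff]
      · simp [θ, B]
      · simp [θ, B]
    have key := sign_minor_eq hw' (b := Sum.inl ∘ b) hb hκ (θ ∘ ![x, y, z])
    simp only [hinl, Function.comp_apply, hA, hB] at key
    rw [det_of_columns fun j r => σ (![x, y, z] j) * A (![x, y, z] j) r,
      det_of_columns fun j r => B (![x, y, z] j) r] at key
    have hscale : tripleDet (fun r => σ x * A x r) (fun r => σ y * A y r)
        (fun r => σ z * A z r) = σ x * σ y * σ z * tripleDet (A x) (A y) (A z) := by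
      simp only [tripleDet]
      ring
    change SignType.sign (tripleDet (fun r => σ x * A x r) (fun r => σ y * A y r)
      (fun r => σ z * A z r)) = SignType.sign (tripleDet (B x) (B y) (B z)) at key
    rw [hscale, sign_mul, sign_pos (mul_pos (mul_pos (hσ x) (hσ y)) (hσ z)), one_mul] at key
    exact key

theorem HaveSameExtensions.sign_bary_eq [Finite X] (h : HaveSameExtensions P Q)
    {b : Fin (d + 1) → X} (hb : (homogMatrix (P ∘ b)).det ≠ 0) (i : X) (l : Fin (d + 1)) :
    SignType.sign (bary (P ∘ b) (P i) l) = SignType.sign (bary (Q ∘ b) (Q i) l) :=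
  _root_.sign_bary_eq h.sign_det_eq hb i l

theorem HaveSameExtensions.bary_mul_le [Finite X] (hd : 2 ≤ d) (h : HaveSameExtensions P Q)
    {b : Fin (d + 1) → X} (hb : (homogMatrix (P ∘ b)).det ≠ 0) {i : X} {j k : Fin (d + 1)}
    (hjk : j ≠ k) (hj : 0 < bary (P ∘ b) (P i) j) (hk : 0 < bary (P ∘ b) (P i) k) :
    bary (Q ∘ b) (Q i) j * bary (P ∘ b) (P i) k ≤
      bary (P ∘ b) (P i) j * bary (Q ∘ b) (Q i) k := by
  -- The third vertex of the plane exists because `2 ≤ d`.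
  obtain ⟨m, hm⟩ : ∃ m, m ∉ ({j, k} : Finset (Fin (d + 1))) := by
    by_contra! hall
    have h1 := Finset.card_le_card (fun x _ => hall x : Finset.univ ⊆ ({j, k} : Finset _))
    rw [Finset.card_univ, Fintype.card_fin] at h1
    have := Finset.card_le_two (a := j) (b := k)
    omega
  simp only [Finset.mem_insert, Finset.mem_singleton, not_or] at hm
  have hκ : Function.Injective ![j, k, m] := by
    intro x y hxy
    fin_cases x <;> fin_cases y <;> simp_all [eq_comm]
  have sgn : ∀ l, 0 < bary (P ∘ b) (P i) l → 0 < bary (Q ∘ b) (Q i) l := fun l hl => by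
    rwa [← sign_eq_one_iff, ← h.sign_bary_eq hb, sign_eq_one_iff]
  exact (h.signTransfer hb hκ i).ratio_le hj hk (sgn j hj) (sgn k hk)

theorem HaveSameExtensions.bary_mul_eq [Finite X] (hd : 2 ≤ d) (h : HaveSameExtensions P Q)
    {b : Fin (d + 1) → X} (hb : (homogMatrix (P ∘ b)).det ≠ 0) {i : X} {j k : Fin (d + 1)}
    (hj : 0 < bary (P ∘ b) (P i) j) (hk : 0 < bary (P ∘ b) (P i) k) :
    bary (P ∘ b) (P i) j * bary (Q ∘ b) (Q i) k =
      bary (P ∘ b) (P i) k * bary (Q ∘ b) (Q i) j := by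
  rcases eq_or_ne j k with rfl | hjk
  · rfl
  have h1 := h.bary_mul_le hd hb hjk hj hk
  have h2 := h.bary_mul_le hd hb hjk.symm hk hj
  linarith

end Extensions

/-! ### Basis exchange and equality of all coordinates -/

section Exchange

variable {d : ℕ}

theorem bary_update_self {b : Fin (d + 1) → Fin d → ℝ} (hb : (homogMatrix b).det ≠ 0)
    {x : Fin d → ℝ} {j : Fin (d + 1)} (hj : bary b x j ≠ 0) :
    bary (Function.update b j x) (b j) j = (bary b x j)⁻¹ := by
  have h1 := det_homogMatrix_update hb j x
  have h2 := det_homogMatrix_update (h1 ▸ mul_ne_zero hb hj) j (b j)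
  rw [Function.update_idem, Function.update_eq_self, h1] at h2
  field_simp
  apply mul_left_cancel₀ hb
  linarith

/-- Solving the expansion of `x` for `b j` flips the sign of the other coordinates; in determinants,
the sign comes from a column swap. -/
theorem bary_update_of_ne {b : Fin (d + 1) → Fin d → ℝ} (hb : (homogMatrix b).det ≠ 0)
    {x : Fin d → ℝ} {j k : Fin (d + 1)} (hjk : k ≠ j) (hj : bary b x j ≠ 0) :
    bary (Function.update b j x) (b j) k = -bary b x k / bary b x j := by
  have h1 := det_homogMatrix_update hb j x
  have h2 := det_homogMatrix_update (h1 ▸ mul_ne_zero hb hj) k (b j)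
  have hswap : homogMatrix (Function.update (Function.update b j x) k (b j)) =
      (homogMatrix (Function.update b k x)).submatrix id (Equiv.swap j k) := by
    ext r l
    simp only [homogMatrix, Matrix.submatrix_apply, Matrix.of_apply, id]
    congr 1
    rcases eq_or_ne l k with rfl | hlk
    · simp [hjk.symm]
    · rcases eq_or_ne l j with rfl | hlj
      · simp [hlk]
      · simp [hlk, hlj, Equiv.swap_apply_of_ne_of_ne]
  rw [hswap, Matrix.det_permute', Equiv.Perm.sign_swap hjk.symm, det_homogMatrix_update hb, h1]
    at h2
  field_simp
  apply mul_left_cancel₀ hb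
  push_cast at h2
  linarith

end Exchange

theorem eq_of_sum_eq_of_proportional {ι : Type*} [Fintype ι] {u v : ι → ℝ}
    (hsum : ∑ l, u l = ∑ l, v l) (hle : ∀ l, u l ≤ 0 → v l = u l)
    (hpos : ∀ j l, 0 < u j → 0 < u l → u j * v l = u l * v j) : u = v := by
  classical
  ext j
  rcases le_or_gt (u j) 0 with hj | hj
  · exact (hle j hj).symm
  have hS : ∑ l with 0 < u l, u l = ∑ l with 0 < u l, v l := by
    rw [← Finset.sum_filter_add_sum_filter_not _ (fun l => 0 < u l) u,
      ← Finset.sum_filter_add_sum_filter_not _ (fun l => 0 < u l) v,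
      Finset.sum_congr rfl fun l hl => hle l (not_lt.1 (Finset.mem_filter.1 hl).2)] at hsum
    exact add_right_cancel hsum
  have hprop : u j * ∑ l with 0 < u l, v l = (∑ l with 0 < u l, u l) * v j := by
    rw [Finset.mul_sum, Finset.sum_mul]
    exact Finset.sum_congr rfl fun l hl => hpos j l hj (Finset.mem_filter.1 hl).2
  have hSpos : 0 < ∑ l with 0 < u l, u l :=
    Finset.sum_pos (fun l hl => (Finset.mem_filter.1 hl).2) ⟨j, by simpa using hj⟩
  rw [← hS, mul_comm] at hprop
  exact mul_left_cancel₀ hSpos.ne' hprop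

theorem HaveSameExtensions.bary_eq {d : ℕ} (hd : 2 ≤ d) {X : Type u} [Finite X]
    {P Q : PointConfig d X} (h : HaveSameExtensions P Q) {b : Fin (d + 1) → X}
    (hb : (homogMatrix (P ∘ b)).det ≠ 0) (i : X) :
    bary (P ∘ b) (P i) = bary (Q ∘ b) (Q i) := by
  have hb' := h.det_ne_zero hb
  refine eq_of_sum_eq_of_proportional ((sum_bary hb _).trans (sum_bary hb' _).symm)
    (fun k hk => ?_) fun j l hj hl => h.bary_mul_eq hd hb hj hl
  rcases hk.eq_or_lt with hk | hk
  · have := h.sign_bary_eq hb i k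
    rw [hk, sign_zero] at this
    rw [hk, sign_eq_zero_iff.1 this.symm]
  -- The coordinates sum to 1, so one is positive.
  obtain ⟨j, -, hj⟩ : ∃ j ∈ Finset.univ, 0 < bary (P ∘ b) (P i) j :=
    Finset.exists_lt_of_sum_lt (f := 0) (by simp [sum_bary hb])
  have hj' : 0 < bary (Q ∘ b) (Q i) j := by
    rwa [← sign_eq_one_iff, ← h.sign_bary_eq hb, sign_eq_one_iff]
  have hkj : k ≠ j := by
    rintro rfl
    exact lt_asymm hj hk
  have hPu : P ∘ Function.update b j i = Function.update (P ∘ b) j (P i) :=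
    Function.comp_update _ _ _ _
  have hQu : Q ∘ Function.update b j i = Function.update (Q ∘ b) j (Q i) :=
    Function.comp_update _ _ _ _
  have hPj : bary (P ∘ Function.update b j i) (P (b j)) j = _ :=
    hPu ▸ bary_update_self hb hj.ne'
  have hQj : bary (Q ∘ Function.update b j i) (Q (b j)) j = _ :=
    hQu ▸ bary_update_self hb' hj'.ne'
  have hPk : bary (P ∘ Function.update b j i) (P (b j)) k = _ :=
    hPu ▸ bary_update_of_ne hb hkj hj.ne'
  have hQk : bary (Q ∘ Function.update b j i) (Q (b j)) k = _ :=
    hQu ▸ bary_update_of_ne hb' hkj hj'.ne'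
  have hdet : (homogMatrix (P ∘ Function.update b j i)).det ≠ 0 := by
    rw [hPu, det_homogMatrix_update hb]
    exact mul_ne_zero hb hj.ne'
  -- In the exchanged basis, the coordinates of the old `j`-th point at `j` and `k` are both
  -- positive, and their ratio is minus the negative coordinate sought.
  have key := h.bary_mul_eq hd hdet (i := b j) (j := j) (k := k)
    (by rw [hPj]; exact inv_pos.2 hj) (by rw [hPk]; exact div_pos (neg_pos.2 hk) hj)
  rw [hPj, hPk, hQj, hQk] at key
  field_simp at key
  linarith

/-! ### Affine maps in homogeneous coordinates -/

/-- The matrix acting on homogeneous coordinates as the affine map `x ↦ A x + v`. -/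
def affineMatrix {d : ℕ} (A : Matrix (Fin d) (Fin d) ℝ) (v : Fin d → ℝ) :
    Matrix (Fin (d + 1)) (Fin (d + 1)) ℝ :=
  Matrix.of (Fin.snoc (fun r => Fin.snoc (A r) (v r)) (Fin.snoc 0 1))

theorem affineMatrix_mulVec_homog {d : ℕ} (A : Matrix (Fin d) (Fin d) ℝ) (v x : Fin d → ℝ) :
    (affineMatrix A v).mulVec (homog x) = homog (A.mulVec x + v) := by
  ext r
  refine Fin.lastCases ?_ (fun r => ?_) r
  · simp [Matrix.mulVec, dotProduct, affineMatrix, Fin.sum_univ_castSucc, homog]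
  · simp [Matrix.mulVec, dotProduct, affineMatrix, Fin.sum_univ_castSucc, homog]

theorem det_affineMatrix {d : ℕ} (A : Matrix (Fin d) (Fin d) ℝ) (v : Fin d → ℝ) :
    (affineMatrix A v).det = A.det := by
  rw [Matrix.det_succ_row _ (Fin.last d), Fin.sum_univ_castSucc, Finset.sum_eq_zero]
  · have hsub : (affineMatrix A v).submatrix (Fin.last d).succAbove (Fin.last d).succAbove = A := by
      ext r l
      simp [affineMatrix]
    rw [hsub, zero_add, ← two_mul]
    simp [affineMatrix]
  · intro l _
    simp [affineMatrix]

theorem homogMatrix_comp_affine {d : ℕ} (A : Matrix (Fin d) (Fin d) ℝ) (v : Fin d → ℝ)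
    (p : Fin (d + 1) → Fin d → ℝ) :
    homogMatrix (fun j => A.mulVec (p j) + v) = affineMatrix A v * homogMatrix p := by
  ext r j
  rw [Matrix.mul_apply]
  exact (congrFun (affineMatrix_mulVec_homog A v (p j)) r).symm

theorem exists_eq_affineMatrix {d : ℕ} {N : Matrix (Fin (d + 1)) (Fin (d + 1)) ℝ}
    (hN : N (Fin.last d) = Pi.single (Fin.last d) 1) : ∃ A v, N = affineMatrix A v := by
  refine ⟨fun r l => N r.castSucc l.castSucc, fun r => N r.castSucc (Fin.last d), ?_⟩
  ext r l
  refine Fin.lastCases ?_ (fun r => ?_) r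
  · rw [hN]
    refine Fin.lastCases ?_ (fun l => ?_) l <;> simp [affineMatrix]
  · refine Fin.lastCases ?_ (fun l => ?_) l <;> simp [affineMatrix]

theorem DirectlyAffinelyEquivalent.symm {d : ℕ} {X : Type u} {P Q : PointConfig d X}
    (h : DirectlyAffinelyEquivalent P Q) : DirectlyAffinelyEquivalent Q P := by
  obtain ⟨φ, hdet, hφ⟩ := h
  refine ⟨φ.symm, ?_, fun i => by rw [hφ, AffineEquiv.symm_apply_apply]⟩
  have hmul : LinearMap.det (φ.symm.linear : (Fin d → ℝ) →ₗ[ℝ] (Fin d → ℝ)) *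
      LinearMap.det (φ.linear : (Fin d → ℝ) →ₗ[ℝ] (Fin d → ℝ)) = 1 :=
    LinearEquiv.det_symm_mul_det φ.linear
  exact pos_of_mul_pos_left (hmul ▸ one_pos) hdet.le

theorem DirectlyAffinelyEquivalent.realizableOnTop {d : ℕ} {X Y : Type u} {P Q : PointConfig d X}
    (h : DirectlyAffinelyEquivalent P Q) {ι : X ↪ Y} {χ : (Fin (d + 1) → Y) → SignType}
    (hP : RealizableOnTop ι χ P) : RealizableOnTop ι χ Q := by
  obtain ⟨φ, hdet, hφ⟩ := h
  obtain ⟨R, hR, rfl⟩ := hP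
  refine ⟨φ ∘ R, fun i => by rw [Function.comp_apply, hR, hφ], ?_⟩
  ext1 t
  have hform : ∀ x, φ x = (LinearMap.toMatrix' (φ.linear : (Fin d → ℝ) →ₗ[ℝ] _)).mulVec x +
      φ 0 := by
    intro x
    rw [LinearMap.toMatrix'_mulVec]
    simpa using φ.map_vadd 0 x
  simp only [chirotope, orientationSign_eq, Function.comp_apply]
  rw [show (fun j => φ (R (t j))) = _ from funext fun j => hform (R (t j)),
    homogMatrix_comp_affine, Matrix.det_mul, det_affineMatrix,
    LinearMap.det_toMatrix', sign_mul, sign_pos hdet, one_mul]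

/-- The matrix taking one homogeneous basis to the other is affine because both have last row all
ones; its determinant is positive because the bases have equal orientation. -/
theorem directlyAffinelyEquivalent_of_bary_eq {d : ℕ} {X : Type u} {P Q : PointConfig d X}
    {b : Fin (d + 1) → X} (hb : (homogMatrix (P ∘ b)).det ≠ 0)
    (hsign : SignType.sign (homogMatrix (P ∘ b)).det = SignType.sign (homogMatrix (Q ∘ b)).det)
    (hbary : ∀ i, bary (P ∘ b) (P i) = bary (Q ∘ b) (Q i)) : DirectlyAffinelyEquivalent P Q := by
  have hb' : (homogMatrix (Q ∘ b)).det ≠ 0 := by rwa [← sign_ne_zero, ← hsign, sign_ne_zero]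
  have hlast : ∀ p : Fin (d + 1) → Fin d → ℝ, homogMatrix p (Fin.last d) = 1 := fun p =>
    funext fun j => homog_last (p j)
  obtain ⟨A, v, hN⟩ := exists_eq_affineMatrix
    (N := homogMatrix (Q ∘ b) * (homogMatrix (P ∘ b))⁻¹) (by
    rw [Matrix.mul_apply_eq_vecMul, hlast, ← hlast (P ∘ b), ← Matrix.mul_apply_eq_vecMul,
      Matrix.mul_nonsing_inv _ hb.isUnit]
    ext l
    simp [Matrix.one_apply, Pi.single_apply, eq_comm])
  have hA : 0 < A.det := by
    rw [← det_affineMatrix A v, ← hN, Matrix.det_mul, Matrix.det_nonsing_inv, Ring.inverse_eq_inv',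
      ← sign_eq_one_iff, sign_mul, ← hsign, ← sign_mul, mul_inv_cancel₀ hb, sign_one]
  let e : (Fin d → ℝ) ≃ₗ[ℝ] (Fin d → ℝ) :=
    LinearEquiv.ofIsUnitDet (v := Pi.basisFun ℝ (Fin d)) (v' := Pi.basisFun ℝ (Fin d))
      (f := Matrix.toLin' A) (by
        rw [← Matrix.toLin_eq_toLin', LinearMap.toMatrix_toLin]; exact hA.ne'.isUnit)
  refine ⟨e.toAffineEquiv.trans (AffineEquiv.constVAdd ℝ (Fin d → ℝ) v), ?_, fun i => ?_⟩
  · have : ((e.toAffineEquiv.trans (AffineEquiv.constVAdd ℝ (Fin d → ℝ) v)).linear :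
        (Fin d → ℝ) →ₗ[ℝ] (Fin d → ℝ)) = Matrix.toLin' A := by
      ext
      rfl
    rwa [this, LinearMap.det_toLin']
  · have h1 : homog (Q i) = homog (A.mulVec (P i) + v) := by
      rw [← affineMatrix_mulVec_homog, ← hN, ← Matrix.mulVec_mulVec,
        ← homogMatrix_mulVec_bary hb' (Q i), ← hbary]
      rfl
    have h2 : Q i = A.mulVec (P i) + v := by
      ext r
      rw [← homog_castSucc (Q i), h1, homog_castSucc]
    rw [h2, add_comm]
    rfl

theorem mainTheorem3 {d : ℕ} (hd : 2 ≤ d) {X : Type u} [Finite X] (P Q : PointConfig d X)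
    (hP : FullDimensional P) (hQ : FullDimensional Q) :
    HaveSameExtensions P Q ↔ DirectlyAffinelyEquivalent P Q := by
  constructor
  · intro h
    obtain ⟨b, hb⟩ := hP.exists_det_ne_zero
    exact directlyAffinelyEquivalent_of_bary_eq hb (h.sign_det_eq b) (h.bary_eq hd hb)
  · intro h Y _ ι χ
    exact ⟨h.realizableOnTop, h.symm.realizableOnTop⟩
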